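/- Let $\Omega=\mathbb F_2^{\mathbb N}$ be the set of infinite sequences of elements of $\mathbb F_2$, let $B$ be the set of all functions from $\Omega$ to $\mathbb F_2$, and let $B_n$ be the set of all functions from $\mathbb F_2^n$ to $\mathbb F_2$. For $g\in B_n$ and $u\in\mathbb F_2^n$ put \[ \Delta_g(u)=\sum_{x\in\mathbb F_2^n}(-1)^{g(x)+g(x+u)},\qquad \Delta(g)=\max_{u\in\mathbb F_2^n\setminus\{0\}}|\Delta_g(u)| . \] For $f\in B$ let $f_n\in B_n$ be its restriction to the first $n$ coordinates, that is, $f_n(x_1,\dots,x_n)=f(x_1,\dots,x_n,0,0,\dots)$. Then there is exactly one probability measure $\mathbb P$ on the $\sigma$-algebra generated by the events $\{f\in B: f_n=g\}$ ($n\ge 0$, $g\in B_n$) such that \[ \mathbb P[f\in B: f_n=g]=2^{-2^n}\qquad\text{for all } n \text{ and all } g\in B_n . \] Moreover, for this measure, and for every probability measure with this property on a larger $\sigma$-algebra on $B$, one has, with $l=2^n$ and $\log$ the natural logarithm, \[ \lim_{n\to\infty}\frac{\Delta(f_n)}{\sqrt{l\log l}}=2\qquad\text{almost surely.} \] -/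

import Mathlib

open MeasureTheory Filter Topology

/-- The set `B_n` of Boolean functions of `n` variables, `𝔽₂ⁿ → 𝔽₂`. -/
abbrev BoolFn (n : ℕ) : Type := (Fin n → ZMod 2) → ZMod 2

/-- `Δ_f(u) = ∑_{x ∈ 𝔽₂ⁿ} (-1)^{f(x) + f(x + u)}`. -/
def autocorr {n : ℕ} (f : BoolFn n) (u : Fin n → ZMod 2) : ℤ :=
  ∑ x : Fin n → ZMod 2, (-1 : ℤ) ^ (f x + f (x + u)).val

/-- The absolute indicator `Δ(f) = max_{u ≠ 0} |Δ_f(u)|` (equal to `0` in the degenerate case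
`n = 0`, where there is no `u ≠ 0`). -/
def absIndicator {n : ℕ} (f : BoolFn n) : ℕ :=
  (Finset.univ.filter fun u : Fin n → ZMod 2 => u ≠ 0).sup fun u => (autocorr f u).natAbs

/-- The set `Ω` of infinite sequences of elements of `𝔽₂`. -/
abbrev BinSeq : Type := ℕ → ZMod 2

/-- The space `B` of functions from `Ω` to `𝔽₂`. (A `def`, so that it carries no measurable
structure other than the one explicitly given.) -/
def InfBoolFn : Type := BinSeq → ZMod 2

/-- The inclusion of `𝔽₂ⁿ` in `Ω`: `(x_0, …, x_{n-1}) ↦ (x_0, …, x_{n-1}, 0, 0, …)`. -/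
def padZero {n : ℕ} (x : Fin n → ZMod 2) : BinSeq :=
  fun i => if h : i < n then x ⟨i, h⟩ else 0

/-- The restriction `f_n ∈ B_n` of `f ∈ B` to the first `n` coordinates. -/
def restrictFirst (n : ℕ) (f : InfBoolFn) : BoolFn n :=
  fun x => f (padZero x)

/-- The σ-algebra on `B` generated by the events `{f : f_n = g}`, `n ∈ ℕ`, `g ∈ B_n`. -/
@[reducible] def cylinderSigma : MeasurableSpace InfBoolFn :=
  MeasurableSpace.generateFrom {s | ∃ (n : ℕ) (g : BoolFn n), s = {f | restrictFirst n f = g}}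

/-- Every restriction `f_n` is uniform on `B_n`: `P[f ∈ B : f_n = g] = 2^{-2^n}` for all `n` and
all `g ∈ B_n`. -/
def HasUniformRestrictions {m : MeasurableSpace InfBoolFn} (P : Measure InfBoolFn) : Prop :=
  ∀ (n : ℕ) (g : BoolFn n), P {f | restrictFirst n f = g} = ((2 : ENNReal) ^ (2 ^ n))⁻¹

open scoped BigOperators

/-! Write l = 2^n. For fixed u ≠ 0 the cosets of {0, u} contribute independent values ±2 to Δ(u), so
Δ(u) behaves like a centred Gaussian of variance 2l. The maximum of |Δ(u)| over about l vectors u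
should then be near √(2 · 2l · log l) = 2 √(l log l).

The upper bound is Chernoff plus a union bound (`expect_absIndicator_ge`). For the lower bound,
cosets of {0, u, v, u + v} show that exp(tΔ(u)) and exp(tΔ(v)) are almost uncorrelated when u ≠ v
(`expect_exp_autocorr_add`). A second moment argument (`expect_sum_eq_zero_le`) is then applied to
truncated exponentials, giving `expect_absIndicator_lt`.

Both failure probabilities are summable in n, so the first Borel–Cantelli lemma concludes, with no
need for independence between the f_n. The measure itself is a product of fair bits, and it is
unique because cylinders form a π-system. -/

/-- The sign `(-1)^a` of `a ∈ 𝔽₂`, as a real number. -/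
def sgn (a : ZMod 2) : ℝ := (-1) ^ a.val

lemma sgn_zero : sgn 0 = 1 := by simp [sgn]

lemma sgn_one : sgn 1 = -1 := by simp [sgn, ZMod.val_one]

lemma sgn_add (a b : ZMod 2) : sgn (a + b) = sgn a * sgn b := by
  have h : (-1 : ℤ) ^ (a + b).val = (-1) ^ a.val * (-1) ^ b.val := by
    revert a b; decide
  unfold sgn; exact_mod_cast h

lemma autocorr_eq_sum_sgn {n : ℕ} (f : BoolFn n) (u : Fin n → ZMod 2) :
    (autocorr f u : ℝ) = ∑ x, sgn (f x) * sgn (f (x + u)) := by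
  simp_rw [← sgn_add]
  simp [autocorr, sgn]

/-! ### Exact exponential moments via coset decompositions -/

/-- Averages over blocks of coordinates are independent. -/
lemma expect_prod_blocks {ι κ G : Type*} [Fintype ι] [DecidableEq ι] [Fintype κ] [DecidableEq κ]
    [Fintype G] [DecidableEq G] (e : ι × κ ≃ G) (φ : (κ → ZMod 2) → ℝ) :
    𝔼 f : G → ZMod 2, ∏ i, φ (fun k => f (e (i, k))) =
      (𝔼 h : κ → ZMod 2, φ h) ^ Fintype.card ι := by
  have h1 : 𝔼 f : G → ZMod 2, ∏ i, φ (fun k => f (e (i, k))) =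
      𝔼 F : ι → κ → ZMod 2, ∏ i, φ (F i) := by
    refine Fintype.expect_equiv ((Equiv.arrowCongr e.symm (Equiv.refl _)).trans
      (Equiv.curry ι κ (ZMod 2))) _ _ fun f => ?_
    rfl
  rw [h1, Fintype.expect_eq_sum_div_card, Fintype.expect_eq_sum_div_card, div_pow]
  congr 1
  · have := Finset.prod_univ_sum (fun _ : ι => (Finset.univ : Finset (κ → ZMod 2))) fun _ h => φ h
    simpa using this.symm
  · simp

/-- Translating by an injective image of `V` decomposes `G` into free `V`-orbits. -/
lemma exists_orbit_equiv {V G : Type*} [AddCommGroup V] [Module (ZMod 2) V]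
    [AddCommGroup G] [Module (ZMod 2) G] (T : V →ₗ[ZMod 2] G) (hT : Function.Injective T) :
    ∃ (C : Submodule (ZMod 2) G) (e : C × V ≃ G), ∀ c a b, e (c, a + b) = e (c, a) + T b := by
  obtain ⟨p, hp⟩ := T.exists_leftInverse_of_injective (LinearMap.ker_eq_bot.2 hT)
  have hp' : ∀ v, p (T v) = v := fun v => LinearMap.congr_fun hp v
  refine ⟨LinearMap.ker p,
    { toFun := fun q => q.1 + T q.2
      invFun := fun x => (⟨x - T (p x), by simp [hp']⟩, p x)
      left_inv := ?_
      right_inv := ?_ }, ?_⟩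
  · rintro ⟨⟨c, hc⟩, v⟩
    have hc' : p c = 0 := hc
    simp [hp', hc']
  · intro x; simp
  · intro c a b; simp [add_assoc]

/-- Each of the k = 2^(n-1) pairs {x, x + u} contributes 2 or -2 with equal probability,
independently of the others. -/
lemma expect_exp_autocorr {n : ℕ} {u : Fin n → ZMod 2} (hu : u ≠ 0) (t : ℝ) :
    ∃ k : ℕ, k * 2 = 2 ^ n ∧
      𝔼 f : BoolFn n, Real.exp (t * autocorr f u) = Real.cosh (2 * t) ^ k := by
  classical
  obtain ⟨C, e, he⟩ := exists_orbit_equiv (LinearMap.toSpanSingleton (ZMod 2) _ u)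
    (by
      intro a b hab
      have : (a - b) • u = 0 := by
        rw [sub_smul, sub_eq_zero]; simpa using hab
      rcases smul_eq_zero.1 this with h | h
      · exact sub_eq_zero.1 h
      · exact absurd h hu)
  have he1 : ∀ c a, e (c, a) + u = e (c, a + 1) := fun c a => by rw [he]; simp
  refine ⟨Fintype.card C, ?_, ?_⟩
  · have := Fintype.card_congr e
    simpa using this
  · let φ (h : ZMod 2 → ZMod 2) : ℝ := Real.exp (t * ∑ a, sgn (h a) * sgn (h (a + 1)))
    have key : ∀ f : BoolFn n, Real.exp (t * autocorr f u) =
        ∏ c : C, φ (fun a => f (e (c, a))) := by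
      intro f
      rw [← Real.exp_sum, ← Finset.mul_sum, autocorr_eq_sum_sgn, ← e.sum_comp,
        Fintype.sum_prod_type]
      simp only [he1]
    refine (Finset.expect_congr rfl fun f _ => key f).trans ((expect_prod_blocks e φ).trans ?_)
    congr 1
    let E : ZMod 2 × ZMod 2 ≃ (ZMod 2 → ZMod 2) := (finTwoArrowEquiv (ZMod 2)).symm
    rw [Fintype.expect_eq_sum_div_card, ← E.sum_comp, Fintype.sum_prod_type]
    have hsum : ∀ F : ZMod 2 → ℝ, ∑ a, F a = F 0 + F 1 := fun F => Fin.sum_univ_two F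
    have h11 : (1 + 1 : ZMod 2) = 0 := rfl
    have e0 : ∀ p : ZMod 2 × ZMod 2, E p (0 : ZMod 2) = p.1 :=
      fun p => rfl
    have e1 : ∀ p : ZMod 2 × ZMod 2, E p (1 : ZMod 2) = p.2 :=
      fun p => rfl
    simp only [φ, hsum, zero_add, h11, e0, e1, sgn_zero, sgn_one]
    rw [Real.cosh_eq]
    simp [ZMod.card]
    ring_nf

/-- Functions on the Klein four-group as quadruples of values. -/
def kleinArrowEquiv : (ZMod 2 × ZMod 2 × ZMod 2 × ZMod 2) ≃ (ZMod 2 × ZMod 2 → ZMod 2) where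
  toFun p q := if q.1 = 0 then (if q.2 = 0 then p.1 else p.2.1)
    else (if q.2 = 0 then p.2.2.1 else p.2.2.2)
  invFun h := (h (0, 0), h (0, 1), h (1, 0), h (1, 1))
  left_inv p := by simp
  right_inv h := by
    have h2 : ∀ a : ZMod 2, a = 0 ∨ a = 1 := by decide
    ext ⟨a, b⟩
    rcases h2 a with rfl | rfl <;> rcases h2 b with rfl | rfl <;> simp

/-- A coset of {0, u, v, u + v} is a 4-cycle whose edges are the steps by u and v, each counted
twice. Of the 16 sign patterns on it, 2 give 8, 2 give -8 and 12 give 0. -/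
lemma expect_exp_autocorr_add {n : ℕ} {u v : Fin n → ZMod 2} (hu : u ≠ 0) (hv : v ≠ 0)
    (huv : u ≠ v) (t : ℝ) :
    ∃ k : ℕ, k * 4 = 2 ^ n ∧
      𝔼 f : BoolFn n, Real.exp (t * (autocorr f u + autocorr f v)) =
        (3 / 4 + Real.cosh (8 * t) / 4) ^ k := by
  classical
  have h2 : ∀ a : ZMod 2, a = 0 ∨ a = 1 := by decide
  have h11 : (1 + 1 : ZMod 2) = 0 := rfl
  obtain ⟨C, e, he⟩ := exists_orbit_equiv ((LinearMap.toSpanSingleton (ZMod 2) _ u).coprod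
      (LinearMap.toSpanSingleton (ZMod 2) _ v))
    (by
      rw [← LinearMap.ker_eq_bot, LinearMap.ker_eq_bot']
      rintro ⟨a, b⟩ hab
      have hab' : a • u + b • v = 0 := by simpa using hab
      rcases h2 a with rfl | rfl <;> rcases h2 b with rfl | rfl
      · rfl
      · simp [hv] at hab'
      · simp [hu] at hab'
      · exfalso
        apply huv
        have : u = -v := by simpa [add_eq_zero_iff_eq_neg] using hab'
        rw [this]; ext i; simp)
  have heu : ∀ c a b, e (c, (a, b)) + u = e (c, (a + 1, b)) := fun c a b => by
    have := he c (a, b) (1, 0)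
    simpa using this.symm
  have hev : ∀ c a b, e (c, (a, b)) + v = e (c, (a, b + 1)) := fun c a b => by
    have := he c (a, b) (0, 1)
    simpa using this.symm
  refine ⟨Fintype.card C, ?_, ?_⟩
  · have := Fintype.card_congr e
    simpa using this
  · let φ (h : ZMod 2 × ZMod 2 → ZMod 2) : ℝ := Real.exp (t * ∑ a, ∑ b,
      (sgn (h (a, b)) * sgn (h (a + 1, b)) + sgn (h (a, b)) * sgn (h (a, b + 1))))
    have key : ∀ f : BoolFn n, Real.exp (t * (autocorr f u + autocorr f v)) =
        ∏ c : C, φ (fun a => f (e (c, a))) := by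
      intro f
      rw [← Real.exp_sum, ← Finset.mul_sum, autocorr_eq_sum_sgn, autocorr_eq_sum_sgn,
        ← Finset.sum_add_distrib, ← e.sum_comp, Fintype.sum_prod_type]
      simp only [Fintype.sum_prod_type, heu, hev]
    refine (Finset.expect_congr rfl fun f _ => key f).trans ((expect_prod_blocks e φ).trans ?_)
    congr 1
    rw [Fintype.expect_eq_sum_div_card, ← kleinArrowEquiv.sum_comp]
    have hsum : ∀ F : ZMod 2 → ℝ, ∑ a, F a = F 0 + F 1 := fun F => Fin.sum_univ_two F
    simp only [φ, Fintype.sum_prod_type, hsum, zero_add, h11, kleinArrowEquiv, Equiv.coe_fn_mk,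
      if_true, one_ne_zero, if_false, sgn_zero, sgn_one]
    rw [Real.cosh_eq]
    norm_num [ZMod.card]
    ring_nf

/-! ### Gaussian bounds for the exponential moments -/

lemma exp_sub_half_sq_le {y : ℝ} (hy : 0 ≤ y) : Real.exp (y - y ^ 2 / 2) ≤ 1 + y := by
  rw [← Real.le_log_iff_exp_le (by linarith)]
  refine le_trans ?_ (Real.le_log_one_add_of_nonneg hy)
  rw [le_div_iff₀ (by linarith)]
  nlinarith [pow_nonneg hy 3]

lemma one_add_half_sq_le_cosh (x : ℝ) : 1 + x ^ 2 / 2 ≤ Real.cosh x := by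
  wlog hx : 0 ≤ x generalizing x
  · simpa using this (-x) (by linarith)
  have h1 : Real.cosh x = 1 + 2 * Real.sinh (x / 2) ^ 2 := by
    have := Real.cosh_two_mul (x / 2)
    rw [Real.cosh_sq, mul_div_cancel₀ _ (two_ne_zero)] at this
    linarith
  have h2 : x / 2 ≤ Real.sinh (x / 2) := Real.self_le_sinh_iff.2 (by linarith)
  nlinarith

lemma exp_le_one_add_add_sq {z : ℝ} (h0 : 0 ≤ z) (h1 : z ≤ 1) : Real.exp z ≤ 1 + z + z ^ 2 := by
  have := (abs_le.1 (Real.abs_exp_sub_one_sub_id_le (abs_le.2 ⟨by linarith, h1⟩))).2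
  linarith

section Moments

variable {n : ℕ} {u v : Fin n → ZMod 2}

lemma expect_exp_autocorr_le (hu : u ≠ 0) (t : ℝ) :
    𝔼 f : BoolFn n, Real.exp (t * autocorr f u) ≤ Real.exp (t ^ 2 * 2 ^ n) := by
  obtain ⟨k, hk, h⟩ := expect_exp_autocorr hu t
  have hk' : (k : ℝ) * 2 = 2 ^ n := by exact_mod_cast hk
  rw [h]
  refine (pow_le_pow_left₀ (Real.cosh_pos _).le (Real.cosh_le_exp_half_sq _) k).trans_eq ?_
  rw [← Real.exp_nat_mul, ← hk']
  ring_nf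

lemma le_expect_exp_autocorr (hu : u ≠ 0) (t : ℝ) :
    Real.exp (t ^ 2 * 2 ^ n - t ^ 4 * 2 ^ n) ≤ 𝔼 f : BoolFn n, Real.exp (t * autocorr f u) := by
  obtain ⟨k, hk, h⟩ := expect_exp_autocorr hu t
  have hk' : (k : ℝ) * 2 = 2 ^ n := by exact_mod_cast hk
  rw [h]
  refine le_trans (le_of_eq ?_) (pow_le_pow_left₀ (Real.exp_pos _).le
    ((exp_sub_half_sq_le (by positivity : 0 ≤ (2 * t) ^ 2 / 2)).trans
      (one_add_half_sq_le_cosh _)) k)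
  rw [← Real.exp_nat_mul, ← hk']
  ring_nf

/-- The main term is the square of the bound exp(t² 2^n) for one vector; the t⁴ term measures the
remaining correlation. -/
lemma expect_exp_autocorr_add_le (hu : u ≠ 0) (hv : v ≠ 0) (huv : u ≠ v) {t : ℝ}
    (ht : 32 * t ^ 2 ≤ 1) :
    𝔼 f : BoolFn n, Real.exp (t * (autocorr f u + autocorr f v)) ≤
      Real.exp (2 * t ^ 2 * 2 ^ n + 64 * t ^ 4 * 2 ^ n) := by
  obtain ⟨k, hk, h⟩ := expect_exp_autocorr_add hu hv huv t
  have hk' : (k : ℝ) * 4 = 2 ^ n := by exact_mod_cast hk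
  rw [h]
  have h1 : Real.cosh (8 * t) ≤ 1 + 32 * t ^ 2 + (32 * t ^ 2) ^ 2 := by
    refine (Real.cosh_le_exp_half_sq _).trans (le_trans (le_of_eq ?_)
      (exp_le_one_add_add_sq (by positivity) ht))
    ring_nf
  have h2 : 3 / 4 + Real.cosh (8 * t) / 4 ≤ Real.exp ((32 * t ^ 2 + (32 * t ^ 2) ^ 2) / 4) := by
    refine le_trans ?_ (Real.add_one_le_exp _)
    linarith
  refine (pow_le_pow_left₀ (by have := Real.cosh_pos (8 * t); positivity) h2 k).trans_eq ?_
  rw [← Real.exp_nat_mul, ← hk']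
  ring_nf

end Moments

/-! ### Upper tail of the absolute indicator -/

lemma natAbs_autocorr_le_absIndicator {n : ℕ} (f : BoolFn n) {u : Fin n → ZMod 2} (hu : u ≠ 0) :
    |(autocorr f u : ℝ)| ≤ absIndicator f := by
  have : (autocorr f u).natAbs ≤ absIndicator f :=
    Finset.le_sup (f := fun u => (autocorr f u).natAbs) (by simpa using hu)
  rw [← Int.cast_abs, Int.abs_eq_natAbs]
  exact_mod_cast this

-- Positivity of `T` rules out the empty supremum 0 that occurs for n = 0.
lemma exists_le_abs_autocorr {n : ℕ} {f : BoolFn n} {T : ℝ} (hT : 0 < T)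
    (h : T ≤ absIndicator f) : ∃ u, u ≠ 0 ∧ T ≤ |(autocorr f u : ℝ)| := by
  by_contra! H
  refine absurd h (not_le.2 ?_)
  refine Finset.sup_induction (p := fun x : ℕ => (x : ℝ) < T) (by simpa using hT) ?_ ?_
  · intro a ha b hb
    rcases max_choice a b with h | h <;> simp only [h, ha, hb]
  · intro u hu
    have := H u (by simpa using hu)
    rwa [← Int.cast_abs, Int.abs_eq_natAbs, Int.cast_natCast] at this

-- Chernoff's bound with a union bound over u; the factor 2 accounts for the two signs of Δ(u).
open Classical in
lemma expect_absIndicator_ge {n : ℕ} {T s : ℝ} (hT : 0 < T) (hs : 0 ≤ s) :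
    𝔼 f : BoolFn n, (if T ≤ absIndicator f then (1 : ℝ) else 0) ≤
      2 * 2 ^ n * Real.exp (s ^ 2 * 2 ^ n - s * T) := by
  have hpt : ∀ f : BoolFn n, (if T ≤ absIndicator f then (1 : ℝ) else 0) ≤
      ∑ u : Fin n → ZMod 2 with u ≠ 0, Real.exp (-(s * T)) *
        (Real.exp (s * autocorr f u) + Real.exp (-s * autocorr f u)) := by
    intro f
    split_ifs with h
    · obtain ⟨u, hu, hTu⟩ := exists_le_abs_autocorr hT h
      refine le_trans ?_ (Finset.single_le_sum (f := fun u => Real.exp (-(s * T)) *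
        (Real.exp (s * autocorr f u) + Real.exp (-s * autocorr f u)))
        (fun i _ => by positivity) (show u ∈ _ by simpa using hu))
      simp only [mul_add, ← Real.exp_add]
      rcases le_abs.1 hTu with h | h
      · have h1 : (1 : ℝ) ≤ Real.exp (-(s * T) + s * autocorr f u) :=
          Real.one_le_exp (by nlinarith)
        have := Real.exp_pos (-(s * T) + -s * autocorr f u)
        linarith
      · have h1 : (1 : ℝ) ≤ Real.exp (-(s * T) + -s * autocorr f u) :=
          Real.one_le_exp (by nlinarith)
        have := Real.exp_pos (-(s * T) + s * autocorr f u)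
        linarith
    · exact Finset.sum_nonneg fun _ _ => by positivity
  refine (Finset.expect_le_expect fun f _ => hpt f).trans ?_
  rw [Finset.expect_sum_comm]
  have hterm : ∀ u ∈ (Finset.univ.filter fun u : Fin n → ZMod 2 => u ≠ 0),
      𝔼 f : BoolFn n, Real.exp (-(s * T)) *
        (Real.exp (s * autocorr f u) + Real.exp (-s * autocorr f u)) ≤
      2 * Real.exp (s ^ 2 * 2 ^ n - s * T) := by
    intro u hu
    have hu' : u ≠ 0 := by simpa using hu
    rw [← Finset.mul_expect, Finset.expect_add_distrib]
    have h1 := expect_exp_autocorr_le hu' s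
    have h2 := expect_exp_autocorr_le hu' (-s)
    rw [neg_sq] at h2
    rw [sub_eq_neg_add, Real.exp_add]
    nlinarith [Real.exp_pos (-(s * T))]
  refine (Finset.sum_le_card_nsmul _ _ _ hterm).trans ?_
  rw [nsmul_eq_mul]
  have hcard : (((Finset.univ.filter fun u : Fin n → ZMod 2 => u ≠ 0).card : ℕ) : ℝ) ≤ 2 ^ n := by
    have := Finset.card_filter_le (Finset.univ : Finset (Fin n → ZMod 2)) (fun u => u ≠ 0)
    simp only [Finset.card_univ, Fintype.card_fun, ZMod.card, Fintype.card_fin] at this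
    exact_mod_cast this
  have := Real.exp_pos (s ^ 2 * 2 ^ n - s * T)
  nlinarith

/-! ### Second moment method -/

open Classical in
/-- A quantitative second moment method: if the first and second moments of the `X u` are close to
those of pairwise uncorrelated variables of mean `K`, their sum rarely vanishes. -/
lemma expect_sum_eq_zero_le {Ω U : Type*} [Fintype Ω] [Nonempty Ω] {s : Finset U}
    (hs : s.Nonempty) {X : U → Ω → ℝ} {p : Ω → Prop} (hp : ∀ ω, p ω → ∑ u ∈ s, X u ω = 0)
    {K η ρ₁ ρ₂ : ℝ} (hK : 0 < K) (hη : 0 ≤ η) (hρ₁ : 0 ≤ ρ₁) (hρ₂ : 0 ≤ ρ₂)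
    (h1 : ∀ u ∈ s, K * (1 - η) ≤ 𝔼 ω, X u ω)
    (h2 : ∀ u ∈ s, ∀ v ∈ s, u ≠ v → 𝔼 ω, X u ω * X v ω ≤ K ^ 2 * (1 + ρ₁))
    (h3 : ∀ u ∈ s, 𝔼 ω, X u ω * X u ω ≤ K ^ 2 * (s.card * ρ₂)) :
    𝔼 ω, (if p ω then (1 : ℝ) else 0) ≤ ρ₁ + ρ₂ + 2 * η := by
  set q := 𝔼 ω, (if p ω then (1 : ℝ) else 0) with hq
  have hq1 : q ≤ 1 := by
    refine (Finset.expect_le_expect (g := fun _ => (1 : ℝ)) fun ω _ => ?_).trans_eq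
      (Fintype.expect_const _)
    split_ifs <;> norm_num
  rcases le_or_gt 1 η with hη1 | hη1
  · linarith
  have hN : (0 : ℝ) < s.card := by exact_mod_cast hs.card_pos
  set N : ℝ := (s.card : ℝ)
  have hmean : N * (K * (1 - η)) ≤ 𝔼 ω, ∑ u ∈ s, X u ω := by
    rw [Finset.expect_sum_comm, ← nsmul_eq_mul]
    exact Finset.card_nsmul_le_sum _ _ _ h1
  have hsq : 𝔼 ω, (∑ u ∈ s, X u ω) ^ 2 ≤ N ^ 2 * (K ^ 2 * (1 + (ρ₁ + ρ₂))) := by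
    simp_rw [sq (∑ u ∈ s, X u _), Finset.sum_mul_sum]
    rw [Finset.expect_sum_comm]
    have hu : ∀ u ∈ s, 𝔼 ω, ∑ v ∈ s, X u ω * X v ω ≤ N * (K ^ 2 * (1 + (ρ₁ + ρ₂))) := by
      intro u hu
      rw [Finset.expect_sum_comm, ← Finset.add_sum_erase _ _ hu]
      have hb : ∑ v ∈ s.erase u, 𝔼 ω, X u ω * X v ω ≤ N * (K ^ 2 * (1 + ρ₁)) := by
        refine (Finset.sum_le_card_nsmul _ _ (K ^ 2 * (1 + ρ₁)) fun v hv => ?_).trans ?_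
        · exact h2 u hu v (Finset.mem_of_mem_erase hv) (Finset.ne_of_mem_erase hv).symm
        · rw [nsmul_eq_mul]
          refine mul_le_mul_of_nonneg_right ?_ (by positivity)
          exact Nat.cast_le.2 (Finset.card_le_card (Finset.erase_subset u s))
      have := h3 u hu
      linarith
    refine (Finset.sum_le_card_nsmul _ _ _ hu).trans_eq ?_
    rw [nsmul_eq_mul]; ring
  -- Cauchy–Schwarz against the indicator of the complement of `p`, outside which the sum vanishes.
  have hcs : (𝔼 ω, ∑ u ∈ s, X u ω) ^ 2 ≤ (𝔼 ω, (∑ u ∈ s, X u ω) ^ 2) * (1 - q) := by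
    have := Finset.expect_mul_sq_le_sq_mul_sq Finset.univ (fun ω => ∑ u ∈ s, X u ω)
      (fun ω => 1 - if p ω then (1 : ℝ) else 0)
    have e1 : ∀ ω, (∑ u ∈ s, X u ω) * (1 - if p ω then (1 : ℝ) else 0) = ∑ u ∈ s, X u ω := by
      intro ω
      by_cases h : p ω
      · simp [hp ω h]
      · simp [h]
    have e2 : ∀ ω, (1 - if p ω then (1 : ℝ) else 0) ^ 2 = 1 - if p ω then (1 : ℝ) else 0 := by
      intro ω; split_ifs <;> norm_num
    simp only [e1, e2, Finset.expect_sub_distrib] at this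
    rwa [Fintype.expect_const] at this
  have hA : (N * (K * (1 - η))) ^ 2 ≤ N ^ 2 * (K ^ 2 * (1 + (ρ₁ + ρ₂))) * (1 - q) := by
    have h0 : 0 ≤ N * (K * (1 - η)) :=
      mul_nonneg hN.le (mul_nonneg hK.le (by linarith))
    exact (pow_le_pow_left₀ h0 hmean 2).trans (hcs.trans
      (mul_le_mul_of_nonneg_right hsq (by linarith)))
  have hB : (1 - η) ^ 2 ≤ (1 + (ρ₁ + ρ₂)) * (1 - q) := by
    have hpos : 0 < N ^ 2 * K ^ 2 := by positivity
    refine le_of_mul_le_mul_left ?_ hpos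
    linarith
  by_contra! hlt
  nlinarith [mul_nonneg hη (add_nonneg hρ₁ hρ₂), sq_nonneg (ρ₁ + ρ₂), sq_nonneg η,
    mul_nonneg (add_nonneg hρ₁ hρ₂) (sub_nonneg.2 hlt.le)]

/-! ### Truncated exponentials and the lower tail -/

/-- The exponential `exp (t x)`, cut off outside the interval `[a, b]`. -/
noncomputable def cutExp (t a b x : ℝ) : ℝ := if a ≤ x ∧ x ≤ b then Real.exp (t * x) else 0

section CutExp

variable {t a b : ℝ}

lemma cutExp_nonneg (x : ℝ) : 0 ≤ cutExp t a b x := by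
  unfold cutExp; split_ifs <;> positivity

lemma cutExp_le (x : ℝ) : cutExp t a b x ≤ Real.exp (t * x) := by
  unfold cutExp; split_ifs <;> [exact le_rfl; positivity]

lemma cutExp_mul_self_le (ht : 0 ≤ t) (x : ℝ) :
    cutExp t a b x * cutExp t a b x ≤ Real.exp (t * b) * Real.exp (t * x) := by
  unfold cutExp
  split_ifs with h
  · gcongr
    exact h.2
  · rw [mul_zero]; positivity

/-- The mass lost above `b` is at most exp(m(x - b)) times exp(tx), and below `a` at most exp(m(a -
x)) times it. Both corrections are again exponentials in x, so their means are known. -/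
lemma le_cutExp {m : ℝ} (hm : 0 ≤ m) (x : ℝ) :
    Real.exp (t * x) - Real.exp (-(m * b)) * Real.exp ((t + m) * x) -
      Real.exp (m * a) * Real.exp ((t - m) * x) ≤ cutExp t a b x := by
  have e1 : Real.exp (-(m * b)) * Real.exp ((t + m) * x) =
      Real.exp (t * x) * Real.exp (m * (x - b)) := by
    rw [← Real.exp_add, ← Real.exp_add]; ring_nf
  have e2 : Real.exp (m * a) * Real.exp ((t - m) * x) =
      Real.exp (t * x) * Real.exp (m * (a - x)) := by
    rw [← Real.exp_add, ← Real.exp_add]; ring_nf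
  rw [e1, e2]
  have p0 := Real.exp_pos (t * x)
  have p1 := Real.exp_pos (m * (x - b))
  have p2 := Real.exp_pos (m * (a - x))
  unfold cutExp
  split_ifs with h
  · nlinarith [mul_pos p0 p1, mul_pos p0 p2]
  · rcases not_and_or.1 h with h | h
    · have : 1 ≤ Real.exp (m * (a - x)) := Real.one_le_exp (mul_nonneg hm (by linarith))
      nlinarith [mul_pos p0 p1]
    · have : 1 ≤ Real.exp (m * (x - b)) := Real.one_le_exp (mul_nonneg hm (by linarith))
      nlinarith [mul_pos p0 p2]

lemma le_expect_cutExp {n : ℕ} {u : Fin n → ZMod 2} (hu : u ≠ 0) {m : ℝ} (hm : 0 ≤ m) :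
    Real.exp (t ^ 2 * 2 ^ n - t ^ 4 * 2 ^ n) - Real.exp ((t + m) ^ 2 * 2 ^ n - m * b) -
      Real.exp ((t - m) ^ 2 * 2 ^ n + m * a) ≤
      𝔼 f : BoolFn n, cutExp t a b (autocorr f u) := by
  refine le_trans ?_ (Finset.expect_le_expect fun f _ => le_cutExp hm (autocorr f u : ℝ))
  rw [Finset.expect_sub_distrib, Finset.expect_sub_distrib, ← Finset.mul_expect,
    ← Finset.mul_expect]
  have h0 := le_expect_exp_autocorr hu t
  have h1 := mul_le_mul_of_nonneg_left (expect_exp_autocorr_le hu (t + m))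
    (Real.exp_pos (-(m * b))).le
  have h2 := mul_le_mul_of_nonneg_left (expect_exp_autocorr_le hu (t - m))
    (Real.exp_pos (m * a)).le
  rw [← Real.exp_add] at h1 h2
  rw [sub_eq_neg_add _ (m * b), add_comm _ (m * a)]
  linarith

end CutExp

-- The cutoff at `b` is essential: the untruncated second moment is about K² l^(2(1-ε)²), too large
-- against K² l for small ε. The cutoff at `a` makes every term vanish when the maximum is below
-- `a`.
open Classical in
lemma expect_absIndicator_lt {n : ℕ} (hn : n ≠ 0) {ε r : ℝ} (hε : 0 < ε) (hε1 : ε < 1)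
    (hr : 0 ≤ r) (hrL : r ^ 2 * 2 ^ n = Real.log (2 ^ n)) (hr1 : 64 * (r ^ 4 * 2 ^ n) ≤ 1)
    (hr2 : 32 * r ^ 2 ≤ 1) :
    𝔼 f : BoolFn n, (if (absIndicator f : ℝ) < (2 - 3 * ε) * (r * 2 ^ n) then (1 : ℝ) else 0) ≤
      130 * (r ^ 4 * 2 ^ n) + 2 * Real.exp (-(ε * Real.log (2 ^ n))) +
        4 * Real.exp (-(ε ^ 2 / 4 * Real.log (2 ^ n))) := by
  -- Under tilting by `t`, Δ(u) has mean about 2t·2^n, the midpoint of [a, b]. The choice of `m`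
  -- minimises both truncation errors, giving the relative error exp(-(ε²/4) L).
  set t := (1 - ε) * r with ht
  set m := ε / 2 * r with hm
  set a := (2 - 3 * ε) * (r * 2 ^ n) with ha
  set b := (2 - ε) * (r * 2 ^ n) with hb
  set K := Real.exp (t ^ 2 * 2 ^ n) with hK
  set L := Real.log (2 ^ n) with hL
  set θ := r ^ 4 * 2 ^ n with hθ
  have hθ0 : 0 ≤ θ := by positivity
  have ht0 : 0 ≤ t := mul_nonneg (by linarith) hr
  have htr : t ≤ r := by nlinarith
  have ht4 : t ^ 4 * 2 ^ n ≤ θ := by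
    have := pow_le_pow_left₀ ht0 htr 4
    exact mul_le_mul_of_nonneg_right this (by positivity)
  have ht2 : 32 * t ^ 2 ≤ 1 := by
    have := pow_le_pow_left₀ ht0 htr 2
    linarith
  set s := Finset.univ.filter fun u : Fin n → ZMod 2 => u ≠ 0 with hs
  have hscard : (s.card : ℝ) = 2 ^ n - 1 := by
    have h1 : s.card = 2 ^ n - 1 := by
      rw [hs, Finset.filter_ne', Finset.card_erase_of_mem (Finset.mem_univ _)]
      simp [ZMod.card]
    rw [h1, Nat.cast_sub Nat.one_le_two_pow]
    simp
  have h2n : (2 : ℝ) ≤ 2 ^ n := by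
    simpa using pow_le_pow_right₀ (one_le_two : (1 : ℝ) ≤ 2) (Nat.one_le_iff_ne_zero.2 hn)
  have hexpL : Real.exp L = 2 ^ n := Real.exp_log (by positivity)
  have key := expect_sum_eq_zero_le (s := s) (Ω := BoolFn n)
    (X := fun u f => cutExp t a b (autocorr f u))
    (p := fun f => (absIndicator f : ℝ) < a) (K := K)
    (η := θ + 2 * Real.exp (-(ε ^ 2 / 4 * L))) (ρ₁ := 128 * θ)
    (ρ₂ := 2 * Real.exp (-(ε * L))) ?_ ?_ (Real.exp_pos _) (by positivity) (by positivity)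
    (by positivity) ?_ ?_ ?_
  · linarith
  · rw [← Finset.card_pos]
    have : (0 : ℝ) < s.card := by linarith
    exact_mod_cast this
  · intro f hf
    refine Finset.sum_eq_zero fun u hu => ?_
    have hu' : u ≠ 0 := by simpa [hs] using hu
    have := (le_abs_self _).trans (natAbs_autocorr_le_absIndicator f hu')
    exact if_neg fun h => absurd h.1 (not_le.2 (this.trans_lt hf))
  · intro u hu
    have hu' : u ≠ 0 := by simpa [hs] using hu
    refine le_trans ?_ (le_expect_cutExp hu' (m := m) (by positivity))
    have e1 : (t + m) ^ 2 * 2 ^ n - m * b = t ^ 2 * 2 ^ n + -(ε ^ 2 / 4 * L) := by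
      rw [← hrL, ht, hm, hb]; ring
    have e2 : (t - m) ^ 2 * 2 ^ n + m * a = t ^ 2 * 2 ^ n + -(ε ^ 2 / 4 * L) := by
      rw [← hrL, ht, hm, ha]; ring
    rw [e1, e2, sub_eq_add_neg (t ^ 2 * 2 ^ n), Real.exp_add, Real.exp_add, ← hK]
    have h3 : 1 - θ ≤ Real.exp (-(t ^ 4 * 2 ^ n)) := by
      have := Real.add_one_le_exp (-(t ^ 4 * 2 ^ n))
      linarith
    have h4 : 0 < K := Real.exp_pos _
    nlinarith
  · intro u hu v hv huv
    have hu' : u ≠ 0 := by simpa [hs] using hu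
    have hv' : v ≠ 0 := by simpa [hs] using hv
    refine le_trans (Finset.expect_le_expect
      (g := fun f : BoolFn n => Real.exp (t * (autocorr f u + autocorr f v))) fun f _ => ?_) ?_
    · rw [mul_add, Real.exp_add]
      exact mul_le_mul (cutExp_le _) (cutExp_le _) (cutExp_nonneg _) (Real.exp_pos _).le
    · refine (expect_exp_autocorr_add_le hu' hv' huv ht2).trans ?_
      rw [Real.exp_add, hK, ← Real.exp_nat_mul]
      have e1 : 2 * t ^ 2 * 2 ^ n = ((2 : ℕ) : ℝ) * (t ^ 2 * 2 ^ n) := by push_cast; ring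
      rw [e1]
      refine mul_le_mul_of_nonneg_left ?_ (Real.exp_pos _).le
      have h5 : Real.exp (64 * t ^ 4 * 2 ^ n) ≤ Real.exp (64 * θ) :=
        Real.exp_le_exp.2 (by linarith)
      have h6 := exp_le_one_add_add_sq (by positivity : 0 ≤ 64 * θ) hr1
      nlinarith
  · intro u hu
    have hu' : u ≠ 0 := by simpa [hs] using hu
    refine le_trans (Finset.expect_le_expect fun f _ => cutExp_mul_self_le ht0 _) ?_
    rw [← Finset.mul_expect]
    refine (mul_le_mul_of_nonneg_left (expect_exp_autocorr_le hu' t) (Real.exp_pos _).le).trans ?_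
    -- This yields the second moment bound K² 2^n exp(-εL); the 2 in ρ₂ absorbs 2^n ≤ 2(2^n - 1).
    have e1 : t * b = t ^ 2 * 2 ^ n + (L + -(ε * L)) := by
      rw [← hrL, ht, hb]; ring
    rw [e1, Real.exp_add, Real.exp_add L, hexpL, ← hK, hscard]
    have h4 : 0 < K ^ 2 := by positivity
    have h5 := Real.exp_pos (-(ε * L))
    nlinarith [mul_nonneg (mul_pos h4 h5).le (sub_nonneg.2 h2n)]

/-! ### Summability of the error terms -/

lemma summable_exp_neg_mul_log_two_pow {κ : ℝ} (hκ : 0 < κ) :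
    Summable fun n : ℕ => Real.exp (-(κ * Real.log ((2 : ℝ) ^ n))) := by
  have h : ∀ n : ℕ, Real.exp (-(κ * Real.log ((2 : ℝ) ^ n))) =
      Real.exp (-(κ * Real.log 2)) ^ n := by
    intro n
    rw [Real.log_pow, ← Real.exp_nat_mul]
    ring_nf
  simp_rw [h]
  refine summable_geometric_of_lt_one (Real.exp_pos _).le ?_
  rw [Real.exp_lt_one_iff]
  have := Real.log_pos one_lt_two
  nlinarith

/-- The scale `√(log l / l)`, `l = 2ⁿ`, of the exponential tilting parameters. -/
noncomputable def tiltScale (n : ℕ) : ℝ := Real.sqrt (Real.log ((2 : ℝ) ^ n) / 2 ^ n)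

lemma log_two_pow_nonneg (n : ℕ) : 0 ≤ Real.log ((2 : ℝ) ^ n) :=
  Real.log_nonneg (one_le_pow₀ one_le_two)

lemma tiltScale_nonneg (n : ℕ) : 0 ≤ tiltScale n := Real.sqrt_nonneg _

lemma tiltScale_sq (n : ℕ) : tiltScale n ^ 2 = Real.log ((2 : ℝ) ^ n) / 2 ^ n :=
  Real.sq_sqrt (div_nonneg (log_two_pow_nonneg n) (by positivity))

lemma tiltScale_sq_mul (n : ℕ) : tiltScale n ^ 2 * 2 ^ n = Real.log ((2 : ℝ) ^ n) := by
  rw [tiltScale_sq, div_mul_cancel₀ _ (by positivity)]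

lemma tiltScale_mul (n : ℕ) :
    tiltScale n * 2 ^ n = Real.sqrt ((2 : ℝ) ^ n * Real.log ((2 : ℝ) ^ n)) := by
  rw [← tiltScale_sq_mul, eq_comm, Real.sqrt_eq_iff_mul_self_eq (by positivity)
    (mul_nonneg (tiltScale_nonneg n) (by positivity))]
  ring

lemma summable_tiltScale_pow_four_mul : Summable fun n : ℕ => tiltScale n ^ 4 * 2 ^ n := by
  have h : ∀ n : ℕ, tiltScale n ^ 4 * 2 ^ n =
      Real.log 2 ^ 2 * ((n : ℝ) ^ 2 * (1 / 2 : ℝ) ^ n) := by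
    intro n
    have e : tiltScale n ^ 4 = (tiltScale n ^ 2) ^ 2 := by ring
    rw [e, tiltScale_sq, Real.log_pow, one_div, inv_pow]
    field_simp
  simp_rw [h]
  exact (summable_pow_mul_geometric_of_norm_lt_one (R := ℝ) 2
    (r := 1 / 2) (by norm_num)).mul_left (Real.log 2 ^ 2)

lemma tendsto_tiltScale_sq : Tendsto (fun n => tiltScale n ^ 2) atTop (𝓝 0) := by
  have h : ∀ n : ℕ, tiltScale n ^ 2 = Real.log 2 * ((n : ℝ) ^ 1 * (1 / 2 : ℝ) ^ n) := by
    intro n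
    rw [tiltScale_sq, Real.log_pow, one_div, inv_pow]
    field_simp
  simp_rw [h]
  simpa using ((summable_pow_mul_geometric_of_norm_lt_one (R := ℝ) 1
    (r := 1 / 2) (by norm_num)).tendsto_atTop_zero).const_mul (Real.log 2)

/-! ### Borel–Cantelli and the almost sure limit -/

-- Only finite subadditivity is used, so the event need not be measurable and any σ-algebra will do.
open Classical in
lemma measure_restrictFirst_le {m : MeasurableSpace InfBoolFn} {P : Measure InfBoolFn}
    (hP : HasUniformRestrictions P) (n : ℕ) (p : BoolFn n → Prop) :
    P {f | p (restrictFirst n f)} ≤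
      ENNReal.ofReal (𝔼 g : BoolFn n, if p g then (1 : ℝ) else 0) := by
  have hU : {f | p (restrictFirst n f)} =
      ⋃ g ∈ Finset.univ.filter p, {f | restrictFirst n f = g} := by
    ext f; simp
  rw [hU]
  refine (measure_biUnion_finset_le _ _).trans_eq ?_
  rw [Finset.sum_congr rfl fun g _ => hP n g, Finset.sum_const, nsmul_eq_mul,
    Fintype.expect_eq_sum_div_card, Finset.sum_boole, ENNReal.ofReal_div_of_pos, div_eq_mul_inv,
    ENNReal.ofReal_natCast, ENNReal.ofReal_natCast]
  · simp [ZMod.card]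
  · exact_mod_cast Fintype.card_pos

open Classical in
/-- The first Borel–Cantelli lemma for events that depend on the restrictions `f_n`. -/
lemma ae_eventually_not_restrictFirst {m : MeasurableSpace InfBoolFn} {P : Measure InfBoolFn}
    (hP : HasUniformRestrictions P) (p : ∀ n, BoolFn n → Prop) {c : ℕ → ℝ} (hc : Summable c)
    (hpc : ∀ᶠ n in atTop, (𝔼 g : BoolFn n, if p n g then (1 : ℝ) else 0) ≤ c n) :
    ∀ᵐ f ∂P, ∀ᶠ n in atTop, ¬ p n (restrictFirst n f) := by
  have hs : Summable fun n => 𝔼 g : BoolFn n, if p n g then (1 : ℝ) else 0 := by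
    refine hc.of_norm_bounded_eventually_nat ?_
    filter_upwards [hpc] with n hn
    rwa [Real.norm_of_nonneg (Finset.expect_nonneg fun g _ => by split_ifs <;> norm_num)]
  refine ae_eventually_notMem (s := fun n => {f | p n (restrictFirst n f)}) ?_
  exact ne_top_of_le_ne_top hs.tsum_ofReal_ne_top
    (ENNReal.tsum_le_tsum fun n => measure_restrictFirst_le hP n (p n))

lemma ae_eventually_absIndicator_lt {m : MeasurableSpace InfBoolFn} {P : Measure InfBoolFn}
    (hP : HasUniformRestrictions P) {ε : ℝ} (hε : 0 < ε) :
    ∀ᵐ f ∂P, ∀ᶠ n in atTop,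
      (absIndicator (restrictFirst n f) : ℝ) < (2 + ε) * (tiltScale n * 2 ^ n) := by
  classical
  have h := ae_eventually_not_restrictFirst hP
    (fun n g => (2 + ε) * (tiltScale n * 2 ^ n) ≤ (absIndicator g : ℝ))
    ((summable_exp_neg_mul_log_two_pow hε).mul_left 2) ?_
  · simpa only [not_le] using h
  · filter_upwards [eventually_gt_atTop 0] with n hn
    have hL : 0 < Real.log ((2 : ℝ) ^ n) := Real.log_pos (one_lt_pow₀ one_lt_two hn.ne')
    have hr : 0 < tiltScale n := Real.sqrt_pos.2 (by positivity)
    -- This `s` equals T / (2·2^n), the minimiser of s² 2^n - sT.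
    refine (expect_absIndicator_ge (s := (1 + ε / 2) * tiltScale n) (by positivity)
      (by positivity)).trans ?_
    have e : ((1 + ε / 2) * tiltScale n) ^ 2 * 2 ^ n -
        (1 + ε / 2) * tiltScale n * ((2 + ε) * (tiltScale n * 2 ^ n)) =
        -(1 + ε / 2) ^ 2 * (tiltScale n ^ 2 * 2 ^ n) := by ring
    rw [e, tiltScale_sq_mul, mul_assoc]
    refine mul_le_mul_of_nonneg_left ?_ zero_le_two
    nth_rewrite 1 [← Real.exp_log (show (0 : ℝ) < 2 ^ n by positivity)]
    rw [← Real.exp_add]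
    refine Real.exp_le_exp.2 ?_
    nlinarith [mul_nonneg hL.le (sq_nonneg ε)]

lemma ae_eventually_le_absIndicator {m : MeasurableSpace InfBoolFn} {P : Measure InfBoolFn}
    (hP : HasUniformRestrictions P) {ε : ℝ} (hε : 0 < ε) (hε1 : ε < 1) :
    ∀ᵐ f ∂P, ∀ᶠ n in atTop,
      (2 - 3 * ε) * (tiltScale n * 2 ^ n) ≤ (absIndicator (restrictFirst n f) : ℝ) := by
  classical
  have h := ae_eventually_not_restrictFirst hP
    (fun n g => (absIndicator g : ℝ) < (2 - 3 * ε) * (tiltScale n * 2 ^ n))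
    (((summable_tiltScale_pow_four_mul.mul_left 130).add
      ((summable_exp_neg_mul_log_two_pow hε).mul_left 2)).add
      ((summable_exp_neg_mul_log_two_pow (show 0 < ε ^ 2 / 4 by positivity)).mul_left 4)) ?_
  · simpa only [not_lt] using h
  · have h1 : ∀ᶠ n in atTop, tiltScale n ^ 4 * 2 ^ n < 1 / 64 :=
      summable_tiltScale_pow_four_mul.tendsto_atTop_zero.eventually_lt_const (by norm_num)
    have h2 : ∀ᶠ n in atTop, tiltScale n ^ 2 < 1 / 32 :=
      tendsto_tiltScale_sq.eventually_lt_const (by norm_num)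
    filter_upwards [eventually_ne_atTop 0, h1, h2] with n hn h1 h2
    exact expect_absIndicator_lt hn hε hε1 (tiltScale_nonneg n) (tiltScale_sq_mul n)
      (by linarith) (by linarith)

lemma ae_tendsto_absIndicator {m : MeasurableSpace InfBoolFn} {P : Measure InfBoolFn}
    (hP : HasUniformRestrictions P) :
    ∀ᵐ f ∂P, Tendsto
      (fun n : ℕ => (absIndicator (restrictFirst n f) : ℝ) /
        Real.sqrt ((2 : ℝ) ^ n * Real.log ((2 : ℝ) ^ n))) atTop (𝓝 2) := by
  -- Countably many ε suffice; the shift by 2 keeps them below 1 even at k = 0.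
  have hε : ∀ k : ℕ, 0 < 1 / ((k : ℝ) + 2) := fun k => by positivity
  have hε1 : ∀ k : ℕ, 1 / ((k : ℝ) + 2) < 1 := fun k => by
    rw [div_lt_one (by positivity)]
    have : (0 : ℝ) ≤ k := k.cast_nonneg
    linarith
  filter_upwards [ae_all_iff.2 fun k : ℕ => ae_eventually_absIndicator_lt hP (hε k),
    ae_all_iff.2 fun k : ℕ => ae_eventually_le_absIndicator hP (hε k) (hε1 k)] with f hup hlow
  rw [Metric.tendsto_nhds]
  intro δ hδ
  obtain ⟨k, hk⟩ := exists_nat_one_div_lt (show 0 < δ / 3 by positivity)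
  have hk' : 1 / ((k : ℝ) + 2) < δ / 3 := by
    refine lt_of_le_of_lt ?_ hk
    gcongr
    norm_num
  filter_upwards [hup k, hlow k, eventually_gt_atTop 0] with n hu hl hn
  have hL : 0 < Real.log ((2 : ℝ) ^ n) := Real.log_pos (one_lt_pow₀ one_lt_two hn.ne')
  have hR : 0 < Real.sqrt ((2 : ℝ) ^ n * Real.log ((2 : ℝ) ^ n)) :=
    Real.sqrt_pos.2 (by positivity)
  rw [tiltScale_mul] at hu hl
  rw [← div_lt_iff₀ hR] at hu
  rw [← le_div_iff₀ hR] at hl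
  rw [Real.dist_eq, abs_lt]
  have := hε k
  constructor <;> linarith

/-! ### Existence and uniqueness of the measure -/

lemma padZero_injective (n : ℕ) : Function.Injective (padZero (n := n)) := by
  intro x y h
  ext i
  have := congrFun h i
  simpa [padZero] using this

lemma restrictFirst_eq_of_le {n k : ℕ} (h : n ≤ k) {f g : InfBoolFn}
    (hfg : restrictFirst k f = restrictFirst k g) : restrictFirst n f = restrictFirst n g := by
  have hpad : ∀ x : Fin n → ZMod 2, padZero x = padZero (fun i : Fin k => padZero x i) := by
    intro x
    ext i
    by_cases hi : i < n
    · simp [padZero, hi, hi.trans_le h]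
    · simp [padZero, hi]
  ext x
  have := congrFun hfg (fun i : Fin k => padZero x i)
  simpa only [restrictFirst, ← hpad x] using this

/-- A longer restriction determines a shorter one, so two cylinders that meet are nested. -/
lemma isPiSystem_cylinders :
    IsPiSystem {s : Set InfBoolFn | ∃ (n : ℕ) (g : BoolFn n), s = {f | restrictFirst n f = g}} := by
  rintro _ ⟨n, g, rfl⟩ _ ⟨k, h, rfl⟩ ⟨f₀, hf₀, hf₀'⟩
  simp only [Set.mem_ofPred_eq] at hf₀ hf₀'
  subst hf₀ hf₀'
  rcases le_total n k with hnk | hnk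
  · refine ⟨k, restrictFirst k f₀, Set.ext fun f => ⟨fun hf => hf.2, fun hf => ⟨?_, hf⟩⟩⟩
    exact restrictFirst_eq_of_le hnk hf
  · refine ⟨n, restrictFirst n f₀, Set.ext fun f => ⟨fun hf => hf.1, fun hf => ⟨hf, ?_⟩⟩⟩
    exact restrictFirst_eq_of_le hnk hf

/-- The distribution of a fair bit. -/
noncomputable def fairBit : Measure (ZMod 2) := (PMF.uniformOfFintype (ZMod 2)).toMeasure

instance : IsProbabilityMeasure fairBit := by unfold fairBit; infer_instance

lemma fairBit_singleton (a : ZMod 2) : fairBit {a} = 2⁻¹ := by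
  rw [fairBit, PMF.toMeasure_apply_singleton _ _ (MeasurableSet.singleton a)]
  simp [ZMod.card]

/-- The law of a sequence of independent fair bits indexed by `Ω`. -/
noncomputable def fairBits : Measure (BinSeq → ZMod 2) := Measure.infinitePi fun _ => fairBit

instance : IsProbabilityMeasure fairBits := by unfold fairBits; infer_instance

/-- Puts a cylinder in the form of a box constraining f at the 2^n padded points, where the product
measure is explicit. -/
lemma setOf_restrictFirst_eq {n : ℕ} (g : BoolFn n) :
    {f : BinSeq → ZMod 2 | restrictFirst n f = g} =
      Set.pi (Finset.univ.map ⟨padZero (n := n), padZero_injective n⟩ : Finset BinSeq)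
        (fun y => {g fun i => y i}) := by
  have hpad : ∀ x : Fin n → ZMod 2, (fun i : Fin n => padZero x i) = x := by
    intro x; ext i; simp [padZero]
  refine Set.ext fun f => ⟨fun hf y hy => ?_, fun hf => funext fun x => ?_⟩
  · obtain ⟨x, -, rfl⟩ := Finset.mem_map.1 (Finset.mem_coe.1 hy)
    exact (congrFun hf x).trans (congrArg g (hpad x).symm)
  · have hx := hf (padZero x) (Finset.mem_coe.2 (Finset.mem_map_of_mem
      ⟨padZero (n := n), padZero_injective n⟩ (Finset.mem_univ x)))
    exact (Set.mem_singleton_iff.1 hx).trans (congrArg g (hpad x))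

lemma measurableSet_restrictFirst {n : ℕ} (g : BoolFn n) :
    MeasurableSet {f : BinSeq → ZMod 2 | restrictFirst n f = g} := by
  rw [setOf_restrictFirst_eq]
  exact MeasurableSet.pi (Finset.countable_toSet _) fun _ _ => MeasurableSet.singleton _

lemma fairBits_restrictFirst {n : ℕ} (g : BoolFn n) :
    fairBits {f | restrictFirst n f = g} = ((2 : ENNReal) ^ (2 ^ n))⁻¹ := by
  rw [setOf_restrictFirst_eq, fairBits,
    Measure.infinitePi_pi _ fun _ _ => MeasurableSet.singleton _]
  simp only [fairBit_singleton, Finset.prod_const]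
  rw [Finset.card_map]
  simp [ZMod.card, ENNReal.inv_pow]

lemma cylinderSigma_le_pi :
    cylinderSigma ≤ (MeasurableSpace.pi : MeasurableSpace (BinSeq → ZMod 2)) := by
  refine MeasurableSpace.generateFrom_le ?_
  rintro _ ⟨n, g, rfl⟩
  exact measurableSet_restrictFirst g

lemma existsUnique_hasUniformRestrictions :
    ∃! P : @Measure InfBoolFn cylinderSigma,
      IsProbabilityMeasure P ∧ HasUniformRestrictions P := by
  refine ⟨@Measure.trim _ cylinderSigma MeasurableSpace.pi fairBits cylinderSigma_le_pi,
    ⟨⟨?_⟩, fun n g => ?_⟩, ?_⟩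
  · exact (trim_measurableSet_eq cylinderSigma_le_pi MeasurableSet.univ).trans measure_univ
  · refine (trim_measurableSet_eq cylinderSigma_le_pi ?_).trans (fairBits_restrictFirst g)
    exact MeasurableSpace.measurableSet_generateFrom ⟨n, g, rfl⟩
  · rintro Q ⟨hQ, hQu⟩
    refine @ext_of_generate_finite _ cylinderSigma Q _ _ rfl isPiSystem_cylinders _ ?_ ?_
    · rintro _ ⟨n, g, rfl⟩
      refine (hQu n g).trans ((fairBits_restrictFirst g).symm.trans
        (trim_measurableSet_eq cylinderSigma_le_pi ?_).symm)
      exact MeasurableSpace.measurableSet_generateFrom ⟨n, g, rfl⟩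
    · have hB : fairBits Set.univ = 1 := measure_univ
      exact measure_univ.trans (hB.symm.trans
        (trim_measurableSet_eq cylinderSigma_le_pi MeasurableSet.univ).symm)

theorem theorem3 :
    -- there is exactly one such probability measure on the σ-algebra generated by the events
    (∃! P : @Measure InfBoolFn cylinderSigma,
      IsProbabilityMeasure P ∧ HasUniformRestrictions P) ∧
    -- almost sure convergence, on any σ-algebra containing these events
    (∀ (m : MeasurableSpace InfBoolFn), cylinderSigma ≤ m →
      ∀ P : @Measure InfBoolFn m, IsProbabilityMeasure P → HasUniformRestrictions P →
        ∀ᵐ f ∂P, Tendsto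
          (fun n : ℕ => (absIndicator (restrictFirst n f) : ℝ) /
            Real.sqrt ((2 : ℝ) ^ n * Real.log ((2 : ℝ) ^ n)))
          atTop (𝓝 2)) :=
  ⟨existsUnique_hasUniformRestrictions, fun _ _ _ _ hP => ae_tendsto_absIndicator hP⟩
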